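/- Let $m,n$ be positive integers with $n\le m\le\binom{2n}{2}$. Let $\mathcal G(2n,m)$ be the set of simple graphs with $2n$ vertices and $m$ edges, let $\operatorname{perfmat} G$ be the number of perfect matchings of $G$, and let $\mu(2n,m)=\max_{G\in\mathcal G(2n,m)}\operatorname{perfmat} G$. Put $$\omega(2n,m)=\bigl(\lfloor \tfrac mn\rfloor!\bigr)^{\frac{n-\alpha}{\lfloor m/n\rfloor}}\bigl(\lceil \tfrac mn\rceil!\bigr)^{\frac{\alpha}{\lceil m/n\rceil}},\qquad \alpha=m-n\lfloor \tfrac mn\rfloor .$$ Call $G$ almost regular if $|\deg u-\deg v|\le 1$ for all vertices $u,v$. For $d=0$ the expression $(d!)^{1/(2d)}$ is read as $0$. (1) For every $G=(V,E)\in\mathcal G(2n,m)$, $$\prod_{v\in V}(\deg(v)!)^{\frac{1}{2\deg(v)}}\le\omega(2n,m),$$ with equality if and only if $G$ is almost regular. Moreover $\operatorname{perfmat} G\le\omega(2n,m)$. (2) $\mu(2n,m)\le\omega(2n,m)$. Equality holds if and only if $\mathcal G(2n,m)$ contains a graph that is a disjoint union $\ell_1K_{n_1,n_1}\cup\ell_2K_{n_1+1,n_1+1}$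 of $\ell_1\ge1$ copies of $K_{n_1,n_1}$ and $\ell_2\ge0$ copies of $K_{n_1+1,n_1+1}$ for some $n_1\ge1$; equivalently, if and only if $n=\ell_1n_1+\ell_2(n_1+1)$ and $m=\ell_1n_1^2+\ell_2(n_1+1)^2$ for some integers $\ell_1\ge1$, $\ell_2\ge0$, $n_1\ge1$. (3) For such $n,m$ and any such $\ell_1,\ell_2,n_1$, a graph $G\in\mathcal G(2n,m)$ satisfies $\operatorname{perfmat} G=\mu(2n,m)$ if and only if $G$ is isomorphic to $\ell_1K_{n_1,n_1}\cup\ell_2K_{n_1+1,n_1+1}$. -/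

import Mathlib

open scoped Nat

namespace PerfMatBound

/-- The graphs on the vertex set `V` with exactly `m` edges. -/
def graphs (V : Type*) (m : ℕ) : Set (SimpleGraph V) :=
  {G | G.edgeSet.ncard = m}

/-- The number of perfect matchings of `G`. -/
noncomputable def perfmat {V : Type*} (G : SimpleGraph V) : ℕ :=
  Nat.card {M : G.Subgraph // M.IsPerfectMatching}

/-- The quantity `(d!) ^ (1 / (2 d))`, with the convention that it is `0` for `d = 0`
(that is, `0! = 0` in this expression, so isolated vertices make the degree product vanish). -/
noncomputable def degFactor (d : ℕ) : ℝ :=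
  if d = 0 then 0 else (d ! : ℝ) ^ (1 / (2 * (d : ℝ)))

/-- `∏_v (deg v)! ^ (1 / (2 deg v))`. -/
noncomputable def degProd {V : Type*} [Fintype V] (G : SimpleGraph V) [DecidableRel G.Adj] : ℝ :=
  ∏ v, degFactor (G.degree v)

/-- Any two degrees differ by at most one. -/
def AlmostRegular {V : Type*} [Fintype V] (G : SimpleGraph V) [DecidableRel G.Adj] : Prop :=
  ∀ u v, |(G.degree u : ℤ) - (G.degree v : ℤ)| ≤ 1

/-- `ω(2n, m) = (⌊m/n⌋!) ^ ((n - α) / ⌊m/n⌋) * (⌈m/n⌉!) ^ (α / ⌈m/n⌉)` with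
`α = m - n ⌊m/n⌋`. The first argument is `n`, half the number of vertices. Here `m / n` is the
floor and `m ⌈/⌉ n` the ceiling of the quotient; both are positive when `0 < n ≤ m`. -/
noncomputable def omega (n m : ℕ) : ℝ :=
  let α : ℝ := (m : ℝ) - (n : ℝ) * ((m / n : ℕ) : ℝ)
  ((m / n)! : ℝ) ^ (((n : ℝ) - α) / ((m / n : ℕ) : ℝ)) *
    ((m ⌈/⌉ n)! : ℝ) ^ (α / ((m ⌈/⌉ n : ℕ) : ℝ))

/-- `μ(2n, m)`, the maximal number of perfect matchings of a graph with `2n` vertices and `m`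
edges. The first argument is `n`, half the number of vertices. -/
noncomputable def mu (n m : ℕ) : ℕ :=
  sSup (perfmat '' graphs (Fin (2 * n)) m)

/-- The disjoint union of `l` copies of `H`. -/
def copies {W : Type*} (l : ℕ) (H : SimpleGraph W) : SimpleGraph (Fin l × W) where
  Adj x y := x.1 = y.1 ∧ H.Adj x.2 y.2
  symm := ⟨fun _ _ h => ⟨h.1.symm, h.2.symm⟩⟩
  loopless := ⟨fun _ h => h.2.ne rfl⟩

/-- The complete bipartite graph `K_{k,k}`. -/
abbrev balancedK (k : ℕ) : SimpleGraph (Fin k ⊕ Fin k) :=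
  completeBipartiteGraph (Fin k) (Fin k)

/-- The disjoint union `l₁ K_{k,k} ∪ l₂ K_{k+1,k+1}`. -/
abbrev unionK (l₁ l₂ k : ℕ) :
    SimpleGraph ((Fin l₁ × (Fin k ⊕ Fin k)) ⊕ (Fin l₂ × (Fin (k + 1) ⊕ Fin (k + 1)))) :=
  SimpleGraph.sum (copies l₁ (balancedK k)) (copies l₂ (balancedK (k + 1)))

end PerfMatBound

/-!
The degree bound `perfmat G ≤ degProd G` is an entropy argument. In a uniformly random perfect
matching `σ` of `G[S]`, the edge at `v` has entropy at most `log (deg v)` by the convexity of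
`x log x`, and given that edge the rest of `σ` is uniform on the perfect matchings of
`G[S \ {v, σ v}]`. Apply induction to these and average over `v`: every neighbour of a vertex `u` is
then removed twice, so `u` loses `2 deg u` neighbours in total. As `d ↦ log (d!) / d` is strictly
concave for `d ≥ 1`, losing two neighbours at once costs more than twice the loss of the first, and
the average is at most the bound for `S`.

In case of equality no step loses two neighbours, so `G` has no triangle; moreover adjacent vertices
have equal degrees, in `G` and after the removal of any edge with its endpoints. Hence vertices with
a common neighbour have the same neighbours, and `G` is a disjoint union of balanced complete
bipartite graphs.

The same concavity, now applied to the degree sequence with its fixed sum `2m`, compares `degProd G`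
with `omega n m`: among integers, the function lies below the line through its values at `⌊m/n⌋` and
`⌊m/n⌋ + 1` and touches it only there.
-/

namespace PerfMatBound

open Finset

section Concavity

variable {f : ℕ → ℝ} {a d q : ℕ}

lemma lt_chord_of_lt (hf : StrictAntiOn (fun i => f (i + 1) - f i) (Set.Ici a))
    (hq : a ≤ q) (hd : q + 1 < d) : f d < f q + (d - q) * (f (q + 1) - f q) := by
  induction d, hd using Nat.le_induction with
  | base =>
    have hdiff := hf hq (Set.mem_Ici.2 (hq.trans q.le_succ)) q.lt_succ_self
    push_cast
    linarith
  | succ d hd ih =>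
    have hdiff := hf hq (Set.mem_Ici.2 (by lia)) (show q < d by lia)
    push_cast
    linarith

lemma lt_chord_of_gt (hf : StrictAntiOn (fun i => f (i + 1) - f i) (Set.Ici a))
    (hd : a ≤ d) (hdq : d < q) : f d < f q + (d - q) * (f (q + 1) - f q) := by
  obtain ⟨t, rfl⟩ := Nat.exists_eq_add_of_lt hdq
  induction t generalizing d with
  | zero =>
    have hdiff := hf hd (Set.mem_Ici.2 (hd.trans d.le_succ)) d.lt_succ_self
    push_cast
    linarith
  | succ t ih =>
    have hdiff := hf hd (Set.mem_Ici.2 (by lia)) hdq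
    have hstep := ih (d := d + 1) (by lia) (by lia)
    rw [show d + 1 + t + 1 = d + (t + 1) + 1 by ring] at hstep
    push_cast at hstep ⊢
    linarith

lemma lt_chord (hf : StrictAntiOn (fun i => f (i + 1) - f i) (Set.Ici a))
    (hq : a ≤ q) (hd : a ≤ d) (h₁ : d ≠ q) (h₂ : d ≠ q + 1) :
    f d < f q + (d - q) * (f (q + 1) - f q) := by
  rcases h₁.lt_or_gt with h | h
  · exact lt_chord_of_gt hf hd h
  · exact lt_chord_of_lt hf hq (by lia)

lemma le_chord (hf : StrictAntiOn (fun i => f (i + 1) - f i) (Set.Ici a))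
    (hq : a ≤ q) (hd : a ≤ d) : f d ≤ f q + (d - q) * (f (q + 1) - f q) := by
  by_cases h₁ : d = q
  · simp [h₁]
  by_cases h₂ : d = q + 1
  · simp [h₂]
  exact (lt_chord hf hq hd h₁ h₂).le

lemma sum_le_chord {ι : Type*} [Fintype ι] {d : ι → ℕ}
    (hf : StrictAntiOn (fun i => f (i + 1) - f i) (Set.Ici a)) (hq : a ≤ q) (hd : ∀ i, a ≤ d i) :
    ∑ i, f (d i) ≤
      Fintype.card ι * f q + (∑ i, (d i : ℝ) - Fintype.card ι * q) * (f (q + 1) - f q) := calc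
  _ ≤ ∑ i, (f q + (d i - q) * (f (q + 1) - f q)) := sum_le_sum fun i _ => le_chord hf hq (hd i)
  _ = _ := by simp [sum_add_distrib, sum_sub_distrib, ← sum_mul]

lemma sum_eq_chord_iff {ι : Type*} [Fintype ι] {d : ι → ℕ}
    (hf : StrictAntiOn (fun i => f (i + 1) - f i) (Set.Ici a)) (hq : a ≤ q) (hd : ∀ i, a ≤ d i) :
    ∑ i, f (d i) =
        Fintype.card ι * f q + (∑ i, (d i : ℝ) - Fintype.card ι * q) * (f (q + 1) - f q) ↔
      ∀ i, d i = q ∨ d i = q + 1 := by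
  have hchord : ∑ i, (f q + (d i - q) * (f (q + 1) - f q)) =
      Fintype.card ι * f q + (∑ i, (d i : ℝ) - Fintype.card ι * q) * (f (q + 1) - f q) := by
    simp [sum_add_distrib, sum_sub_distrib, ← sum_mul]
  rw [← hchord, sum_eq_sum_iff_of_le fun i _ => le_chord hf hq (hd i)]
  refine ⟨fun h i => ?_, fun h i _ => ?_⟩
  · by_contra! hi
    exact (lt_chord hf hq (hd i) hi.1 hi.2).ne (h i (mem_univ i))
  · rcases h i with hi | hi <;> simp [hi]

lemma two_mul_sum_range_add_lt (hf : StrictAnti fun i => f (i + 1) - f i) (d : ℕ) :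
    2 * ∑ i ∈ range (d + 1), f i + (d + 1) * (d + 2) * f (d + 2) <
      (d + 1) * (d + 4) * f (d + 1) := by
  induction d with
  | zero =>
    have := hf Nat.zero_lt_one
    norm_num at this ⊢
    linarith
  | succ d ih =>
    have := mul_lt_mul_of_pos_left (hf (Nat.lt_add_one (d + 1)))
      (show (0 : ℝ) < (d + 2) * (d + 3) by positivity)
    rw [sum_range_succ]
    push_cast
    ring_nf at ih this ⊢
    linarith

lemma average_succ_sub_lt (hf : StrictAnti fun i => f (i + 1) - f i) (d : ℕ) :
    (∑ i ∈ range (d + 3), f i) / (d + 3 : ℕ) - (∑ i ∈ range (d + 2), f i) / (d + 2 : ℕ) <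
      (∑ i ∈ range (d + 2), f i) / (d + 2 : ℕ) - (∑ i ∈ range (d + 1), f i) / (d + 1 : ℕ) := by
  have hgap := sub_pos.2 (two_mul_sum_range_add_lt hf d)
  rw [← sub_pos, sum_range_succ _ (d + 2), sum_range_succ _ (d + 1)]
  set s := ∑ i ∈ range (d + 1), f i
  calc (0 : ℝ) < ((d + 1) * (d + 4) * f (d + 1) - (2 * s + (d + 1) * (d + 2) * f (d + 2))) /
        ((d + 1) * (d + 2) * (d + 3)) := by positivity
    _ = _ := by
      push_cast
      field_simp
      ring

lemma strictAntiOn_average_succ_sub (hf : StrictAnti fun i => f (i + 1) - f i) :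
    StrictAntiOn (fun d : ℕ => (∑ i ∈ range (d + 1), f i) / (d + 1 : ℕ) -
      (∑ i ∈ range d, f i) / d) (Set.Ici 1) := by
  refine strictAntiOn_of_succ_lt Set.ordConnected_Ici fun d _ hd _ => ?_
  obtain ⟨e, rfl⟩ := Nat.exists_eq_add_of_le' (Set.mem_Ici.1 hd)
  exact average_succ_sub_lt hf e

end Concavity

section LogFactorial

/-- The logarithm of `(d!) ^ (1 / d)`, with value `0` at `d = 0`. It turns the degree product and
`omega` into sums. -/
noncomputable def logFac (d : ℕ) : ℝ := Real.log (d ! : ℝ) / d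

variable {d t : ℕ}

lemma log_factorial_eq_sum (d : ℕ) :
    Real.log (d ! : ℝ) = ∑ i ∈ range d, Real.log ((i : ℝ) + 1) := by
  rw [← prod_range_add_one_eq_factorial, Nat.cast_prod, Real.log_prod fun i _ => by positivity]
  simp

lemma logFac_nonneg (d : ℕ) : 0 ≤ logFac d :=
  div_nonneg (Real.log_nonneg (by exact_mod_cast d.factorial_pos)) d.cast_nonneg

lemma mul_logFac (d : ℕ) : d * logFac d = Real.log (d ! : ℝ) := by
  rcases eq_or_ne d 0 with rfl | hd
  · simp
  · exact mul_div_cancel₀ _ (Nat.cast_ne_zero.2 hd)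

lemma log_sub_logFac_pred (hd : d ≠ 0) :
    Real.log d - logFac (d - 1) = d * (logFac d - logFac (d - 1)) := by
  obtain ⟨e, rfl⟩ := Nat.exists_eq_add_one_of_ne_zero hd
  have h := mul_logFac (e + 1)
  rw [Nat.factorial_succ, Nat.cast_mul, Real.log_mul (by positivity) (by positivity),
    ← mul_logFac e] at h
  push_cast at h ⊢
  linarith

lemma strictAnti_log_succ_sub :
    StrictAnti fun i : ℕ => Real.log ((i + 1 : ℕ) + 1 : ℝ) - Real.log ((i : ℝ) + 1) := by
  refine strictAnti_nat_of_succ_lt fun i => ?_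
  rw [← Real.log_div (by positivity) (by positivity),
    ← Real.log_div (by positivity) (by positivity)]
  refine Real.log_lt_log (by positivity) ?_
  push_cast
  rw [div_lt_div_iff₀ (by positivity) (by positivity)]
  linarith

lemma strictAntiOn_logFac_succ_sub :
    StrictAntiOn (fun d => logFac (d + 1) - logFac d) (Set.Ici 1) := by
  simpa only [logFac, log_factorial_eq_sum] using
    strictAntiOn_average_succ_sub strictAnti_log_succ_sub

lemma logFac_sub_lt (ht : 2 ≤ t) (htd : t < d) :
    logFac (d - t) + t * (logFac d - logFac (d - 1)) < logFac d := by
  obtain ⟨q, rfl⟩ : ∃ q, d = q + 1 := ⟨d - 1, by lia⟩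
  have := lt_chord strictAntiOn_logFac_succ_sub (q := q) (d := q + 1 - t) (by lia) (by lia)
    (by lia) (by lia)
  rw [Nat.cast_sub htd.le] at this
  push_cast at this
  rw [Nat.add_sub_cancel]
  linarith

lemma logFac_sub_le (htd : t ≤ 1 ∨ t < d) :
    logFac (d - t) + t * (logFac d - logFac (d - 1)) ≤ logFac d := by
  rcases lt_or_ge t 2 with ht | ht
  · interval_cases t <;> simp
  · exact (logFac_sub_lt ht (htd.resolve_left (by lia))).le

end LogFactorial

section LogSum

variable {ι : Type*} {t : Finset ι} {f : ι → ℝ}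

lemma sum_mul_log_card_add_log_sub (ht : t.Nonempty) :
    ∑ i ∈ t, f i * (Real.log #t + Real.log (f i)) - (∑ i ∈ t, f i) * Real.log (∑ i ∈ t, f i) =
      #t * (∑ i ∈ t, (#t : ℝ)⁻¹ • (f i * Real.log (f i)) -
        (∑ i ∈ t, (#t : ℝ)⁻¹ • f i) * Real.log (∑ i ∈ t, (#t : ℝ)⁻¹ • f i)) := by
  have hcard : (#t : ℝ) ≠ 0 := by exact_mod_cast ht.card_ne_zero
  simp only [smul_eq_mul, mul_add, sum_add_distrib, ← sum_mul, ← mul_sum]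
  rcases eq_or_ne (∑ i ∈ t, f i) 0 with hsum | hsum
  · simp [hsum, hcard]
  · rw [Real.log_mul (inv_ne_zero hcard) hsum, Real.log_inv]
    field_simp
    ring

lemma sum_mul_log_sum_le (hf : ∀ i ∈ t, 0 ≤ f i) :
    (∑ i ∈ t, f i) * Real.log (∑ i ∈ t, f i) ≤
      ∑ i ∈ t, f i * (Real.log #t + Real.log (f i)) := by
  rcases t.eq_empty_or_nonempty with rfl | ht
  · simp
  have hcard : (#t : ℝ) ≠ 0 := by exact_mod_cast ht.card_ne_zero
  rw [← sub_nonneg, sum_mul_log_card_add_log_sub ht]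
  exact mul_nonneg (Nat.cast_nonneg _) (sub_nonneg.2
    (Real.strictConvexOn_mul_log.convexOn.map_sum_le (fun _ _ => by positivity)
      (by simp [hcard]) hf))

lemma mul_card_eq_sum_of_sum_mul_log_sum_eq (hf : ∀ i ∈ t, 0 ≤ f i)
    (h : (∑ i ∈ t, f i) * Real.log (∑ i ∈ t, f i) =
      ∑ i ∈ t, f i * (Real.log #t + Real.log (f i))) {i : ι} (hi : i ∈ t) :
    f i * #t = ∑ j ∈ t, f j := by
  have ht : t.Nonempty := ⟨i, hi⟩
  have hcard : (#t : ℝ) ≠ 0 := by exact_mod_cast ht.card_ne_zero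
  have hgap := sum_mul_log_card_add_log_sub (f := f) ht
  rw [← h, sub_self, zero_eq_mul, or_iff_right hcard, sub_eq_zero] at hgap
  rw [(Real.strictConvexOn_mul_log.map_sum_eq_iff (fun _ _ => by positivity)
    (by simp [hcard]) hf).1 hgap.symm i hi, ← smul_sum, smul_eq_mul]
  field_simp

end LogSum

section Matchings

variable {V : Type*} (G : SimpleGraph V) [DecidableRel G.Adj]

/-- The number of neighbours of `v` in `S`, that is, for `v ∈ S`, the degree of `v` in the subgraph
induced on `S`. -/
def degOn (S : Finset V) (v : V) : ℕ := #{w ∈ S | G.Adj v w}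

/-- The logarithm of the degree product `∏_{v ∈ S} (d_v!) ^ (1 / (2 d_v))` of the subgraph induced
on `S`, in which an isolated vertex contributes the factor `1`. -/
noncomputable def logBound (S : Finset V) : ℝ :=
  ∑ v ∈ S, logFac (degOn G S v) / 2

variable {G}

lemma logBound_nonneg (S : Finset V) : 0 ≤ logBound G S :=
  sum_nonneg fun _ _ => div_nonneg (logFac_nonneg _) zero_le_two

variable [DecidableEq V] {S T : Finset V} {v w : V}

lemma degOn_sdiff_add (hTS : T ⊆ S) (v : V) :
    degOn G (S \ T) v + degOn G T v = degOn G S v := by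
  rw [degOn, degOn, ← card_union_of_disjoint (disjoint_filter_filter sdiff_disjoint),
    ← filter_union, sdiff_union_of_subset hTS, degOn]

variable [Fintype V] (G)

/-- The perfect matchings of the subgraph of `G` induced on `S`, encoded as the involutions of `V`
that move every vertex of `S` to a neighbour and fix every vertex outside `S`. -/
def matchingsOn (S : Finset V) : Finset (Equiv.Perm V) :=
  {σ | (∀ v, σ (σ v) = v) ∧ (∀ v ∈ S, G.Adj v (σ v)) ∧ ∀ v ∉ S, σ v = v}

variable {G} {σ : Equiv.Perm V}

lemma mem_matchingsOn : σ ∈ matchingsOn G S ↔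
    (∀ v, σ (σ v) = v) ∧ (∀ v ∈ S, G.Adj v (σ v)) ∧ ∀ v ∉ S, σ v = v := by
  simp [matchingsOn]

lemma involutive_of_mem_matchingsOn (hσ : σ ∈ matchingsOn G S) : Function.Involutive σ :=
  (mem_matchingsOn.1 hσ).1

lemma adj_apply_of_mem_matchingsOn (hσ : σ ∈ matchingsOn G S) (hv : v ∈ S) : G.Adj v (σ v) :=
  (mem_matchingsOn.1 hσ).2.1 v hv

lemma apply_mem_of_mem_matchingsOn (hσ : σ ∈ matchingsOn G S) (hv : v ∈ S) : σ v ∈ S := by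
  by_contra h
  have := adj_apply_of_mem_matchingsOn hσ hv
  rw [← (mem_matchingsOn.1 hσ).2.2 _ h, involutive_of_mem_matchingsOn hσ] at this
  exact this.ne rfl

lemma pair_subset_of_mem_matchingsOn (hσ : σ ∈ matchingsOn G S) (hv : v ∈ S) :
    {v, σ v} ⊆ S :=
  insert_subset hv (singleton_subset_iff.2 (apply_mem_of_mem_matchingsOn hσ hv))

lemma sum_comp_of_mem_matchingsOn {M : Type*} [AddCommMonoid M] (hσ : σ ∈ matchingsOn G S)
    (f : V → M) : ∑ v ∈ S, f (σ v) = ∑ v ∈ S, f v :=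
  sum_nbij' σ σ (fun _ => apply_mem_of_mem_matchingsOn hσ)
    (fun _ => apply_mem_of_mem_matchingsOn hσ) (fun v _ => involutive_of_mem_matchingsOn hσ v)
    (fun v _ => involutive_of_mem_matchingsOn hσ v) fun _ _ => rfl

lemma mul_swap_mem_matchingsOn_sdiff (hσ : σ ∈ matchingsOn G S) :
    σ * Equiv.swap v (σ v) ∈ matchingsOn G (S \ {v, σ v}) := by
  rw [mem_matchingsOn] at hσ ⊢
  obtain ⟨hinv, hadj, hfix⟩ := hσ
  refine ⟨fun x => ?_, fun x hx => ?_, fun x hx => ?_⟩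
  all_goals simp only [Equiv.Perm.mul_apply, Equiv.swap_apply_def]; grind

lemma mul_swap_mem_matchingsOn (hσ : σ ∈ matchingsOn G (S \ {v, w})) (hv : v ∈ S) (hw : w ∈ S)
    (hvw : G.Adj v w) : σ * Equiv.swap v w ∈ matchingsOn G S := by
  rw [mem_matchingsOn] at hσ ⊢
  obtain ⟨hinv, hadj, hfix⟩ := hσ
  have hwv := hvw.symm
  refine ⟨fun x => ?_, fun x hx => ?_, fun x hx => ?_⟩
  all_goals simp only [Equiv.Perm.mul_apply, Equiv.swap_apply_def]; grind

lemma card_filter_apply_eq (hv : v ∈ S) (hw : w ∈ S) (hvw : G.Adj v w) :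
    #{σ ∈ matchingsOn G S | σ v = w} = #(matchingsOn G (S \ {v, w})) := by
  refine card_bij' (fun σ _ => σ * Equiv.swap v w) (fun σ _ => σ * Equiv.swap v w)
    (fun σ hσ => ?_) (fun σ hσ => ?_) (fun σ _ => by simp [mul_assoc])
    (fun σ _ => by simp [mul_assoc])
  · obtain ⟨hmem, rfl⟩ := mem_filter.1 hσ
    exact mul_swap_mem_matchingsOn_sdiff hmem
  · refine mem_filter.2 ⟨mul_swap_mem_matchingsOn hσ hv hw hvw, ?_⟩
    simpa using (mem_matchingsOn.1 hσ).2.2 w (by simp)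

lemma matchingsOn_sdiff_nonempty (hσ : σ ∈ matchingsOn G S) :
    (matchingsOn G (S \ {v, σ v})).Nonempty :=
  ⟨_, mul_swap_mem_matchingsOn_sdiff hσ⟩

lemma degOn_pos (hσ : σ ∈ matchingsOn G S) (hv : v ∈ S) : 0 < degOn G S v :=
  card_pos.2 ⟨σ v, mem_filter.2
    ⟨apply_mem_of_mem_matchingsOn hσ hv, adj_apply_of_mem_matchingsOn hσ hv⟩⟩

lemma sum_comp_apply_eq_sum_card_mul (hv : v ∈ S) (g : V → ℝ) :
    ∑ σ ∈ matchingsOn G S, g (σ v) =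
      ∑ w ∈ S with G.Adj v w, #(matchingsOn G (S \ {v, w})) * g w := by
  rw [← sum_fiberwise_of_maps_to (t := {w ∈ S | G.Adj v w}) (g := fun σ : Equiv.Perm V => σ v)
    fun σ hσ => mem_filter.2
      ⟨apply_mem_of_mem_matchingsOn hσ hv, adj_apply_of_mem_matchingsOn hσ hv⟩]
  refine sum_congr rfl fun w hw => ?_
  obtain ⟨hwS, hvw⟩ := mem_filter.1 hw
  rw [← card_filter_apply_eq hv hwS hvw, ← nsmul_eq_mul, ← sum_const]
  exact sum_congr rfl fun σ hσ => by rw [(mem_filter.1 hσ).2]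

lemma card_matchingsOn_eq_sum (hv : v ∈ S) :
    (#(matchingsOn G S) : ℝ) = ∑ w ∈ S with G.Adj v w, (#(matchingsOn G (S \ {v, w})) : ℝ) := by
  simpa using sum_comp_apply_eq_sum_card_mul hv fun _ => 1

lemma card_mul_log_card_matchingsOn_le (hv : v ∈ S) :
    #(matchingsOn G S) * Real.log #(matchingsOn G S) ≤ ∑ σ ∈ matchingsOn G S,
      (Real.log (degOn G S v) + Real.log #(matchingsOn G (S \ {v, σ v}))) := by
  rw [sum_comp_apply_eq_sum_card_mul hv fun w =>
    Real.log (degOn G S v) + Real.log #(matchingsOn G (S \ {v, w})), card_matchingsOn_eq_sum hv]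
  exact sum_mul_log_sum_le fun _ _ => Nat.cast_nonneg _

lemma card_matchingsOn_sdiff_mul_degOn (hv : v ∈ S)
    (h : #(matchingsOn G S) * Real.log #(matchingsOn G S) = ∑ σ ∈ matchingsOn G S,
      (Real.log (degOn G S v) + Real.log #(matchingsOn G (S \ {v, σ v}))))
    (hw : w ∈ S) (hvw : G.Adj v w) :
    #(matchingsOn G (S \ {v, w})) * degOn G S v = #(matchingsOn G S) := by
  rw [sum_comp_apply_eq_sum_card_mul hv fun w =>
    Real.log (degOn G S v) + Real.log #(matchingsOn G (S \ {v, w})),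
    card_matchingsOn_eq_sum hv] at h
  have := mul_card_eq_sum_of_sum_mul_log_sum_eq (fun _ _ => Nat.cast_nonneg _) h
    (mem_filter.2 ⟨hw, hvw⟩)
  rw [← card_matchingsOn_eq_sum hv] at this
  exact_mod_cast this

lemma degOn_pair_eq_one (hσ : σ ∈ matchingsOn G S) (hv : v ∈ S) {u : V}
    (hu : u ∈ ({v, σ v} : Finset V)) : degOn G {v, σ v} u = 1 := by
  have hadj := adj_apply_of_mem_matchingsOn hσ hv
  rcases mem_insert.1 hu with rfl | hu
  · simp [degOn, filter_insert, filter_singleton, hadj]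
  · rw [mem_singleton.1 hu]
    simp [degOn, filter_insert, filter_singleton, hadj.symm]

lemma degOn_pair_le_one_or_lt (hσ : σ ∈ matchingsOn G S) (hv : v ∈ S) {u : V} (hu : u ∈ S) :
    degOn G {v, σ v} u ≤ 1 ∨ degOn G {v, σ v} u < degOn G S u := by
  by_cases huv : u ∈ ({v, σ v} : Finset V)
  · exact .inl (degOn_pair_eq_one hσ hv huv).le
  · have hadd := degOn_sdiff_add (G := G) (pair_subset_of_mem_matchingsOn hσ hv) u
    have hpos := degOn_pos (mul_swap_mem_matchingsOn_sdiff (v := v) hσ) (mem_sdiff.2 ⟨hu, huv⟩)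
    lia

lemma sum_degOn_pair (hσ : σ ∈ matchingsOn G S) (u : V) :
    ∑ v ∈ S, degOn G {v, σ v} u = 2 * degOn G S u := by
  have hpair (v : V) (hv : v ∈ S) : degOn G {v, σ v} u =
      (if G.Adj u v then 1 else 0) + if G.Adj u (σ v) then 1 else 0 := by
    rw [degOn, card_filter, sum_pair (adj_apply_of_mem_matchingsOn hσ hv).ne]
  rw [sum_congr rfl hpair, sum_add_distrib,
    sum_comp_of_mem_matchingsOn hσ fun w => if G.Adj u w then 1 else 0, ← card_filter, degOn,
    two_mul]

lemma logFac_degOn_sdiff (hσ : σ ∈ matchingsOn G S) (hv : v ∈ S) (u : V) :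
    logFac (degOn G (S \ {v, σ v}) u) =
      logFac (degOn G S u - degOn G {v, σ v} u) := by
  rw [← degOn_sdiff_add (G := G) (pair_subset_of_mem_matchingsOn hσ hv) u,
    Nat.add_sub_cancel]

lemma logBound_sdiff (hσ : σ ∈ matchingsOn G S) (hv : v ∈ S) :
    logBound G (S \ {v, σ v}) = ∑ u ∈ S, logFac (degOn G S u - degOn G {v, σ v} u) / 2 -
      (logFac (degOn G S v - 1) + logFac (degOn G S (σ v) - 1)) / 2 := by
  have hsub := pair_subset_of_mem_matchingsOn hσ hv
  rw [logBound, eq_sub_iff_add_eq, ← sum_sdiff hsub,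
    sum_pair (adj_apply_of_mem_matchingsOn hσ hv).ne, degOn_pair_eq_one hσ hv (by simp),
    degOn_pair_eq_one hσ hv (by simp), add_div]
  simp only [logFac_degOn_sdiff hσ hv]

lemma sum_log_degOn_add_logBound_sdiff (hσ : σ ∈ matchingsOn G S) :
    ∑ v ∈ S, (Real.log (degOn G S v) + logBound G (S \ {v, σ v})) =
      ∑ v ∈ S, ∑ u ∈ S, (logFac (degOn G S u - degOn G {v, σ v} u) +
        degOn G {v, σ v} u * (logFac (degOn G S u) - logFac (degOn G S u - 1))) / 2 := by
  have hpartner : ∑ v ∈ S, (logFac (degOn G S v - 1) + logFac (degOn G S (σ v) - 1)) / 2 =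
      ∑ v ∈ S, logFac (degOn G S v - 1) := by
    rw [← sum_div, sum_add_distrib,
      sum_comp_of_mem_matchingsOn hσ fun v => logFac (degOn G S v - 1), add_self_div_two]
  have hlinear : ∑ v ∈ S, ∑ u ∈ S,
      degOn G {v, σ v} u * (logFac (degOn G S u) - logFac (degOn G S u - 1)) / 2 =
        ∑ u ∈ S, (Real.log (degOn G S u) - logFac (degOn G S u - 1)) := by
    rw [sum_comm]
    refine sum_congr rfl fun u hu => ?_
    rw [← sum_div, ← sum_mul, ← Nat.cast_sum, sum_degOn_pair hσ,
      log_sub_logFac_pred (degOn_pos hσ hu).ne']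
    push_cast
    ring
  rw [sum_add_distrib, sum_congr rfl fun v hv => logBound_sdiff hσ hv, sum_sub_distrib, hpartner]
  simp only [add_div, sum_add_distrib, hlinear, sum_sub_distrib]
  ring

lemma sum_log_degOn_add_logBound_sdiff_le (hσ : σ ∈ matchingsOn G S) :
    ∑ v ∈ S, (Real.log (degOn G S v) + logBound G (S \ {v, σ v})) ≤ #S * logBound G S := by
  rw [sum_log_degOn_add_logBound_sdiff hσ, ← nsmul_eq_mul, ← sum_const]
  refine sum_le_sum fun v hv => sum_le_sum fun u hu => ?_
  gcongr
  exact logFac_sub_le (degOn_pair_le_one_or_lt hσ hv hu)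

lemma degOn_pair_le_one_of_sum_log_degOn_eq (hσ : σ ∈ matchingsOn G S)
    (h : ∑ v ∈ S, (Real.log (degOn G S v) + logBound G (S \ {v, σ v})) = #S * logBound G S)
    (hv : v ∈ S) {u : V} (hu : u ∈ S) : degOn G {v, σ v} u ≤ 1 := by
  by_contra! htwo
  refine h.not_lt ?_
  have hterm (v : V) (hv : v ∈ S) (u : V) (hu : u ∈ S) := div_le_div_of_nonneg_right
    (logFac_sub_le (degOn_pair_le_one_or_lt hσ hv hu)) zero_le_two
  rw [sum_log_degOn_add_logBound_sdiff hσ, ← nsmul_eq_mul, ← sum_const]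
  refine sum_lt_sum (fun v hv => sum_le_sum (hterm v hv))
    ⟨v, hv, sum_lt_sum (hterm v hv) ⟨u, hu, ?_⟩⟩
  gcongr
  exact logFac_sub_lt htwo ((degOn_pair_le_one_or_lt hσ hv hu).resolve_left htwo.not_ge)

lemma sum_card_mul_log_card_le (S : Finset V) :
    #S * (#(matchingsOn G S) * Real.log #(matchingsOn G S)) ≤ ∑ σ ∈ matchingsOn G S, ∑ v ∈ S,
      (Real.log (degOn G S v) + Real.log #(matchingsOn G (S \ {v, σ v}))) := by
  rw [sum_comm, ← nsmul_eq_mul, ← sum_const]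
  exact sum_le_sum fun v hv => card_mul_log_card_matchingsOn_le hv

lemma sum_sum_log_degOn_add_logBound_sdiff_le (S : Finset V) :
    ∑ σ ∈ matchingsOn G S, ∑ v ∈ S, (Real.log (degOn G S v) + logBound G (S \ {v, σ v})) ≤
      #S * (#(matchingsOn G S) * logBound G S) := calc
  _ ≤ ∑ _σ ∈ matchingsOn G S, #S * logBound G S :=
    sum_le_sum fun _ hσ => sum_log_degOn_add_logBound_sdiff_le hσ
  _ = _ := by rw [sum_const, nsmul_eq_mul]; ring

theorem log_card_matchingsOn_le_logBound (S : Finset V) :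
    Real.log #(matchingsOn G S) ≤ logBound G S := by
  induction S using Finset.strongInduction with
  | H S ih =>
  rcases (matchingsOn G S).eq_empty_or_nonempty with hM | hM
  · simpa [hM] using logBound_nonneg S
  rcases S.eq_empty_or_nonempty with rfl | hS
  · have : #(matchingsOn G ∅) ≤ 1 := card_le_one.2 fun σ hσ τ hτ => Equiv.ext fun v => by
      simp_all [mem_matchingsOn]
    rw [le_antisymm this hM.card_pos]
    simpa using logBound_nonneg ∅
  have hstep : #S * (#(matchingsOn G S) * Real.log #(matchingsOn G S)) ≤
      #S * (#(matchingsOn G S) * logBound G S) := calc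
    _ ≤ _ := sum_card_mul_log_card_le S
    _ ≤ ∑ σ ∈ matchingsOn G S, ∑ v ∈ S,
        (Real.log (degOn G S v) + logBound G (S \ {v, σ v})) := by
      gcongr with σ hσ v hv
      exact ih _ (sdiff_ssubset (pair_subset_of_mem_matchingsOn hσ hv) (by simp))
    _ ≤ _ := sum_sum_log_degOn_add_logBound_sdiff_le S
  have hS' : (0 : ℝ) < #S := by exact_mod_cast hS.card_pos
  have hM' : (0 : ℝ) < #(matchingsOn G S) := by exact_mod_cast hM.card_pos
  exact le_of_mul_le_mul_left (le_of_mul_le_mul_left hstep hS') hM'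

/-- `S` induces a subgraph of `G` that has a perfect matching and attains equality in the degree
bound `log_card_matchingsOn_le_logBound`. -/
def IsTight (G : SimpleGraph V) [DecidableRel G.Adj] (S : Finset V) : Prop :=
  (matchingsOn G S).Nonempty ∧ Real.log #(matchingsOn G S) = logBound G S

namespace IsTight

lemma chain_eq (h : IsTight G S) :
    #S * (#(matchingsOn G S) * Real.log #(matchingsOn G S)) = ∑ σ ∈ matchingsOn G S, ∑ v ∈ S,
      (Real.log (degOn G S v) + Real.log #(matchingsOn G (S \ {v, σ v}))) ∧
    ∑ σ ∈ matchingsOn G S, ∑ v ∈ S,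
      (Real.log (degOn G S v) + Real.log #(matchingsOn G (S \ {v, σ v}))) =
    ∑ σ ∈ matchingsOn G S, ∑ v ∈ S, (Real.log (degOn G S v) + logBound G (S \ {v, σ v})) ∧
    ∑ σ ∈ matchingsOn G S, ∑ v ∈ S, (Real.log (degOn G S v) + logBound G (S \ {v, σ v})) =
      #S * (#(matchingsOn G S) * logBound G S) := by
  have hentropy := sum_card_mul_log_card_le (G := G) S
  have hinduction : ∑ σ ∈ matchingsOn G S, ∑ v ∈ S,
      (Real.log (degOn G S v) + Real.log #(matchingsOn G (S \ {v, σ v}))) ≤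
      ∑ σ ∈ matchingsOn G S, ∑ v ∈ S, (Real.log (degOn G S v) + logBound G (S \ {v, σ v})) := by
    gcongr
    exact log_card_matchingsOn_le_logBound _
  have hconcave := sum_sum_log_degOn_add_logBound_sdiff_le (G := G) S
  rw [h.2] at hentropy ⊢
  exact ⟨by linarith, by linarith, by linarith⟩

lemma card_mul_log_card (h : IsTight G S) (hv : v ∈ S) :
    #(matchingsOn G S) * Real.log #(matchingsOn G S) = ∑ σ ∈ matchingsOn G S,
      (Real.log (degOn G S v) + Real.log #(matchingsOn G (S \ {v, σ v}))) := by
  have hsum := h.chain_eq.1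
  rw [sum_comm, ← nsmul_eq_mul, ← sum_const] at hsum
  exact (sum_eq_sum_iff_of_le fun v hv => card_mul_log_card_matchingsOn_le hv).1 hsum v hv

lemma sum_log_degOn_add_logBound_sdiff (h : IsTight G S) (hσ : σ ∈ matchingsOn G S) :
    ∑ v ∈ S, (Real.log (degOn G S v) + logBound G (S \ {v, σ v})) = #S * logBound G S := by
  have hsum := h.chain_eq.2.2
  rw [mul_left_comm, ← nsmul_eq_mul, ← sum_const] at hsum
  exact (sum_eq_sum_iff_of_le fun σ hσ => sum_log_degOn_add_logBound_sdiff_le hσ).1 hsum σ hσ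

lemma sdiff_pair_apply (h : IsTight G S) (hσ : σ ∈ matchingsOn G S) (hv : v ∈ S) :
    IsTight G (S \ {v, σ v}) := by
  have hterm (σ : Equiv.Perm V) (v : V) :=
    add_le_add_right (log_card_matchingsOn_le_logBound (G := G) (S \ {v, σ v}))
      (Real.log (degOn G S v))
  have hsum := (sum_eq_sum_iff_of_le fun σ _ => sum_le_sum fun v _ => hterm σ v).1 h.chain_eq.2.1
  have hlog := (sum_eq_sum_iff_of_le fun v _ => hterm σ v).1 (hsum σ hσ) v hv
  exact ⟨matchingsOn_sdiff_nonempty hσ, add_left_cancel hlog⟩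

lemma card_sdiff_mul_degOn (h : IsTight G S) (hv : v ∈ S) (hw : w ∈ S) (hvw : G.Adj v w) :
    #(matchingsOn G (S \ {v, w})) * degOn G S v = #(matchingsOn G S) :=
  card_matchingsOn_sdiff_mul_degOn hv (h.card_mul_log_card hv) hw hvw

lemma exists_apply_eq (h : IsTight G S) (hv : v ∈ S) (hw : w ∈ S) (hvw : G.Adj v w) :
    ∃ σ ∈ matchingsOn G S, σ v = w := by
  have hne : (matchingsOn G (S \ {v, w})).Nonempty := by
    rw [← card_pos]
    exact Nat.pos_of_mul_pos_right ((h.card_sdiff_mul_degOn hv hw hvw).symm ▸ h.1.card_pos)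
  obtain ⟨σ, hσ⟩ := card_pos.1 ((card_filter_apply_eq hv hw hvw).symm ▸ hne.card_pos)
  exact ⟨σ, (mem_filter.1 hσ).1, (mem_filter.1 hσ).2⟩

lemma sdiff_pair (h : IsTight G S) (hv : v ∈ S) (hw : w ∈ S) (hvw : G.Adj v w) :
    IsTight G (S \ {v, w}) := by
  obtain ⟨σ, hσ, rfl⟩ := h.exists_apply_eq hv hw hvw
  exact h.sdiff_pair_apply hσ hv

lemma degOn_eq_of_adj (h : IsTight G S) (hv : v ∈ S) (hw : w ∈ S) (hvw : G.Adj v w) :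
    degOn G S v = degOn G S w := by
  have hv' := h.card_sdiff_mul_degOn hv hw hvw
  have hw' := h.card_sdiff_mul_degOn hw hv hvw.symm
  rw [pair_comm, ← hv'] at hw'
  refine (Nat.eq_of_mul_eq_mul_left (Nat.pos_of_ne_zero fun h0 => ?_) hw').symm
  rw [h0, zero_mul] at hv'
  exact h.1.card_pos.ne hv'

lemma not_adj_of_adj_of_adj (h : IsTight G S) {u : V} (hu : u ∈ S) (hv : v ∈ S) (hw : w ∈ S)
    (hvw : G.Adj v w) (huv : G.Adj u v) : ¬ G.Adj u w := by
  intro huw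
  obtain ⟨σ, hσ, rfl⟩ := h.exists_apply_eq hv hw hvw
  have hle := degOn_pair_le_one_of_sum_log_degOn_eq hσ
    (h.sum_log_degOn_add_logBound_sdiff hσ) hv hu
  have htwo : degOn G {v, σ v} u = 2 := by
    rw [degOn, filter_true_of_mem (by simp [huv, huw]), card_pair hvw.ne]
  lia

lemma adj_of_adj_of_adj_of_adj (h : IsTight G S) {u v c d : V} (hu : u ∈ S) (hv : v ∈ S)
    (hc : c ∈ S) (hd : d ∈ S) (huc : G.Adj u c) (hvc : G.Adj v c) (hud : G.Adj u d) :
    G.Adj v d := by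
  rcases eq_or_ne u v with rfl | huv
  · exact hud
  rcases eq_or_ne c d with rfl | hcd
  · exact hvc
  have hdv : d ≠ v := by
    rintro rfl
    exact h.not_adj_of_adj_of_adj hu hd hc hvc hud huc
  have hdc : ¬ G.Adj d c := fun hdc =>
    h.not_adj_of_adj_of_adj hd hu hc huc hud.symm hdc
  -- `u` and `d` have equal degrees both in `S` and in the tight set obtained by removing the edge
  -- `vc`, hence equally many neighbours in `{v, c}`; `u` has `c`, and `d` cannot have `c`.
  have hdeg := h.degOn_eq_of_adj hu hd hud
  have hdeg' := (h.sdiff_pair hv hc hvc).degOn_eq_of_adj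
    (by simp [hu, huv, huc.ne]) (by simp [hd, hdv, hcd.symm]) hud
  have hsub : {v, c} ⊆ S := by simp [insert_subset_iff, hv, hc]
  have hpair : degOn G {v, c} d = degOn G {v, c} u := by
    have := degOn_sdiff_add (G := G) hsub u
    have := degOn_sdiff_add (G := G) hsub d
    lia
  have hpos : 0 < degOn G {v, c} d :=
    hpair ▸ card_pos.2 ⟨c, by simp [huc]⟩
  obtain ⟨w, hw⟩ := card_pos.1 hpos
  grind [SimpleGraph.adj_comm]

end IsTight

end Matchings

section PerfectMatchings

variable {V W : Type*} {G : SimpleGraph V} {H : SimpleGraph W} {σ : Equiv.Perm V}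

/-- The perfect matchings of `G`, encoded as the involutions moving every vertex to a neighbour. -/
def matchingInvolutions (G : SimpleGraph V) : Set (Equiv.Perm V) :=
  {σ | Function.Involutive σ ∧ ∀ v, G.Adj v (σ v)}

/-- The spanning subgraph of `G` whose edges are the orbits of a matching involution. -/
def matchingSubgraph (σ : matchingInvolutions G) : G.Subgraph where
  verts := Set.univ
  Adj v w := σ.1 v = w
  adj_sub := by rintro v w rfl; exact σ.2.2 v
  edge_vert _ := Set.mem_univ _
  symm := ⟨by rintro v w rfl; exact σ.2.1 v⟩

lemma isPerfectMatching_matchingSubgraph (σ : matchingInvolutions G) :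
    (matchingSubgraph σ).IsPerfectMatching :=
  SimpleGraph.Subgraph.isPerfectMatching_iff.2 fun _ => existsUnique_eq'

lemma exists_matchingSubgraph_eq {M : G.Subgraph} (hM : M.IsPerfectMatching) :
    ∃ σ, matchingSubgraph σ = M := by
  choose f hf hunique using SimpleGraph.Subgraph.isPerfectMatching_iff.1 hM
  have hinv : Function.Involutive f := fun v => (hunique _ v (hf v).symm).symm
  refine ⟨⟨hinv.toPerm, hinv, fun v => (hf v).adj_sub⟩, SimpleGraph.Subgraph.ext ?_ ?_⟩
  · exact (SimpleGraph.Subgraph.isSpanning_iff.1 hM.2).symm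
  · ext v w
    exact ⟨fun hvw => (show f v = w from hvw) ▸ hf v, fun hvw => (hunique v w hvw).symm⟩

lemma perfmat_eq_card_matchingInvolutions (G : SimpleGraph V) :
    perfmat G = Nat.card (matchingInvolutions G) := by
  refine (Nat.card_eq_of_bijective
    (fun σ => ⟨matchingSubgraph σ, isPerfectMatching_matchingSubgraph σ⟩)
    ⟨fun σ τ hστ => ?_, fun M => ?_⟩).symm
  · refine Subtype.ext (Equiv.ext fun v => ?_)
    have heq : matchingSubgraph σ = matchingSubgraph τ := congrArg Subtype.val hστ
    have hadj : (matchingSubgraph σ).Adj v (τ.1 v) := heq ▸ rfl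
    exact hadj
  · obtain ⟨σ, hσ⟩ := exists_matchingSubgraph_eq M.2
    exact ⟨σ, Subtype.ext hσ⟩

lemma perfmat_eq_card_matchingsOn [Fintype V] [DecidableEq V] [DecidableRel G.Adj] :
    perfmat G = #(matchingsOn G univ) := by
  rw [perfmat_eq_card_matchingInvolutions]
  exact Nat.subtype_card _ fun σ => by
    simp [mem_matchingsOn, matchingInvolutions, Function.Involutive]

lemma degOn_univ [Fintype V] [DecidableRel G.Adj] (v : V) : degOn G univ v = G.degree v := by
  rw [degOn, ← SimpleGraph.card_neighborFinset_eq_degree, SimpleGraph.neighborFinset_eq_filter]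

lemma permCongr_mem_matchingInvolutions_iff (ψ : G ≃g H) :
    ψ.toEquiv.permCongr σ ∈ matchingInvolutions H ↔ σ ∈ matchingInvolutions G := by
  have hconj (v : V) : ψ.toEquiv.permCongr σ (ψ v) = ψ (σ v) :=
    congrArg (fun x => ψ (σ x)) (ψ.symm_apply_apply v)
  simp only [matchingInvolutions, Function.Involutive, Set.mem_ofPred_eq, ψ.surjective.forall,
    hconj, ψ.map_adj_iff, ψ.injective.eq_iff]

lemma perfmat_congr (ψ : G ≃g H) : perfmat G = perfmat H := by
  rw [perfmat_eq_card_matchingInvolutions, perfmat_eq_card_matchingInvolutions]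
  exact Nat.card_congr (ψ.toEquiv.permCongr.subtypeEquiv fun σ =>
    (permCongr_mem_matchingInvolutions_iff ψ).symm)

lemma perfmat_mul_perfmat_le [Finite V] [Finite W] :
    perfmat G * perfmat H ≤ perfmat (G.sum H) := by
  simp only [perfmat_eq_card_matchingInvolutions, ← Nat.card_prod]
  refine Nat.card_le_card_of_injective
    (fun σ => ⟨Equiv.Perm.sumCongr σ.1.1 σ.2.1, ?_, ?_⟩) fun σ τ hστ => ?_
  · rintro (v | w)
    exacts [congrArg Sum.inl (σ.1.2.1 v), congrArg Sum.inr (σ.2.2.1 w)]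
  · rintro (v | w)
    exacts [σ.1.2.2 v, σ.2.2.2 w]
  · have heq : Equiv.Perm.sumCongrHom V W (σ.1.1, σ.2.1) =
        Equiv.Perm.sumCongrHom V W (τ.1.1, τ.2.1) := congrArg Subtype.val hστ
    simpa [Prod.ext_iff, Subtype.ext_iff] using Equiv.Perm.sumCongrHom_injective heq

lemma perfmat_pow_le_perfmat_copies [Finite W] (l : ℕ) :
    perfmat H ^ l ≤ perfmat (copies l H) := by
  have hcard : perfmat H ^ l = Nat.card (Fin l → matchingInvolutions H) := by
    rw [Nat.card_fun, Nat.card_fin, perfmat_eq_card_matchingInvolutions]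
  rw [hcard, perfmat_eq_card_matchingInvolutions]
  refine Nat.card_le_card_of_injective
    (fun σ => ⟨Equiv.prodCongrRight fun i => (σ i).1, fun v => ?_, fun v => ⟨rfl, ?_⟩⟩)
    fun σ τ hστ => funext fun i => Subtype.ext (Equiv.ext fun w => ?_)
  · exact Prod.ext rfl ((σ v.1).2.1 v.2)
  · exact (σ v.1).2.2 v.2
  · exact congrArg Prod.snd (Equiv.congr_fun (congrArg Subtype.val hστ) (i, w))

lemma factorial_le_perfmat_balancedK (k : ℕ) : k ! ≤ perfmat (balancedK k) := by
  have hcard : k ! = Nat.card (Equiv.Perm (Fin k)) := by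
    rw [Nat.card_perm, Nat.card_fin]
  rw [hcard, perfmat_eq_card_matchingInvolutions]
  refine Nat.card_le_card_of_injective
    (fun π => ⟨(Equiv.sumCongr π π.symm).trans (Equiv.sumComm _ _), ?_, ?_⟩) fun π ρ hπρ => ?_
  · rintro (i | i) <;> simp
  · rintro (i | i) <;> simp
  · refine Equiv.ext fun i => ?_
    simpa using Equiv.congr_fun (congrArg Subtype.val hπρ) (Sum.inl i)

lemma factorial_pow_mul_factorial_pow_le_perfmat_unionK (l₁ l₂ k : ℕ) :
    k ! ^ l₁ * (k + 1)! ^ l₂ ≤ perfmat (unionK l₁ l₂ k) := calc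
  _ ≤ perfmat (balancedK k) ^ l₁ * perfmat (balancedK (k + 1)) ^ l₂ := by
    gcongr <;> exact factorial_le_perfmat_balancedK _
  _ ≤ perfmat (copies l₁ (balancedK k)) * perfmat (copies l₂ (balancedK (k + 1))) := by
    gcongr <;> exact perfmat_pow_le_perfmat_copies _
  _ ≤ _ := perfmat_mul_perfmat_le

end PerfectMatchings

section DegreeProduct

lemma forall_abs_sub_le_one_iff {ι : Type*} [Fintype ι] {d : ι → ℕ} :
    (∀ i j, |(d i : ℤ) - d j| ≤ 1) ↔
      ∀ i, d i = (∑ j, d j) / Fintype.card ι ∨ d i = (∑ j, d j) / Fintype.card ι + 1 := by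
  refine ⟨fun h i => ?_, fun h i j => abs_le.2 (by have := h i; have := h j; lia)⟩
  set q := (∑ j, d j) / Fintype.card ι
  have hcard : 0 < Fintype.card ι := Fintype.card_pos_iff.2 ⟨i⟩
  have hlower : ∑ _j : ι, q ≤ ∑ j, d j := by
    simpa using Nat.mul_div_le (∑ j, d j) (Fintype.card ι)
  have hupper : ∑ j, d j < ∑ _j : ι, (q + 1) := by
    simpa using Nat.lt_mul_div_succ (∑ j, d j) hcard
  by_contra! hne
  rcases lt_or_ge (d i) q with hi | hi
  · refine hlower.not_gt (sum_lt_sum (fun l _ => ?_) ⟨i, mem_univ i, hi⟩)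
    have := abs_le.1 (h l i)
    lia
  · refine hupper.not_ge (sum_le_sum fun l _ => ?_)
    have := abs_le.1 (h i l)
    lia

variable {n m : ℕ}

lemma ceilDiv_eq_div_add_one (hn : 0 < n) (h : ¬ n ∣ m) : m ⌈/⌉ n = m / n + 1 := by
  refine le_antisymm ((ceilDiv_le_iff_le_mul hn).2 (Nat.lt_mul_div_succ m hn).le) ?_
  refine Nat.lt_of_mul_lt_mul_left (a := n) ?_
  exact ((Nat.mul_div_le m n).lt_of_ne fun heq => h ⟨_, heq.symm⟩).trans_le
    (le_smul_ceilDiv hn)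

lemma omega_pos (n m : ℕ) : 0 < omega n m := by
  rw [omega]
  positivity

lemma log_omega (hn : 0 < n) :
    Real.log (omega n m) = n * logFac (m / n) +
      (m - n * (m / n : ℕ)) * (logFac (m / n + 1) - logFac (m / n)) := by
  rw [omega, Real.log_mul (by positivity) (by positivity), Real.log_rpow (by positivity),
    Real.log_rpow (by positivity), div_mul_eq_mul_div₀, div_mul_eq_mul_div₀, mul_div_assoc,
    mul_div_assoc, ← logFac, ← logFac]
  by_cases h : n ∣ m
  · rw [← Nat.cast_mul, Nat.mul_div_cancel' h]
    ring
  · rw [ceilDiv_eq_div_add_one hn h]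
    ring

lemma degFactor_nonneg (d : ℕ) : 0 ≤ degFactor d := by
  rw [degFactor]
  positivity

lemma degFactor_eq_zero_iff {d : ℕ} : degFactor d = 0 ↔ d = 0 := by
  by_cases hd : d = 0
  · simp [degFactor, hd]
  · simp only [degFactor, hd, if_false, iff_false]
    positivity

lemma log_degFactor (d : ℕ) : Real.log (degFactor d) = logFac d / 2 := by
  by_cases hd : d = 0
  · simp [degFactor, logFac, hd]
  · rw [degFactor, if_neg hd, Real.log_rpow (by positivity), logFac]
    field_simp

variable {V : Type*} [Fintype V] {G : SimpleGraph V} [DecidableRel G.Adj]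

lemma degProd_nonneg : 0 ≤ degProd G := prod_nonneg fun _ _ => degFactor_nonneg _

lemma degProd_pos_iff : 0 < degProd G ↔ ∀ v, G.degree v ≠ 0 := by
  rw [degProd_nonneg.lt_iff_ne', degProd, prod_ne_zero_iff]
  simp [degFactor_eq_zero_iff]

lemma log_degProd (hG : 0 < degProd G) : Real.log (degProd G) = logBound G univ := by
  rw [degProd, Real.log_prod fun v hv => (prod_ne_zero_iff.1 hG.ne') v hv, logBound]
  exact sum_congr rfl fun v _ => by rw [log_degFactor, degOn_univ]

lemma degree_ne_zero_of_perfmat_ne_zero (h : perfmat G ≠ 0) (v : V) : G.degree v ≠ 0 := by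
  classical
  rw [perfmat_eq_card_matchingsOn] at h
  obtain ⟨σ, hσ⟩ := card_ne_zero.1 h
  rw [← degOn_univ]
  exact (degOn_pos hσ (mem_univ v)).ne'

theorem perfmat_le_degProd : (perfmat G : ℝ) ≤ degProd G := by
  classical
  rcases eq_or_ne (perfmat G) 0 with h | h
  · simpa [h] using degProd_nonneg
  have hpos := degProd_pos_iff.2 (degree_ne_zero_of_perfmat_ne_zero h)
  rw [← Real.log_le_log_iff (by positivity) hpos, log_degProd hpos, perfmat_eq_card_matchingsOn]
  exact log_card_matchingsOn_le_logBound univ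

lemma isTight_univ_of_perfmat_eq_degProd [DecidableEq V] (hG : 0 < degProd G)
    (h : (perfmat G : ℝ) = degProd G) : IsTight G univ := by
  have hlog := log_degProd hG
  rw [← h, perfmat_eq_card_matchingsOn] at hG hlog
  exact ⟨card_pos.1 (by exact_mod_cast hG), hlog⟩

lemma sum_degrees_of_mem_graphs (hG : G ∈ graphs V m) : ∑ v, G.degree v = 2 * m := by
  classical
  rw [SimpleGraph.sum_degrees_eq_twice_card_edges, ← Set.ncard_coe_finset,
    SimpleGraph.coe_edgeFinset, show G.edgeSet.ncard = m from hG]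

lemma almostRegular_iff (hV : Fintype.card V = 2 * n) (hG : G ∈ graphs V m) :
    AlmostRegular G ↔ ∀ v, G.degree v = m / n ∨ G.degree v = m / n + 1 := by
  rw [AlmostRegular, forall_abs_sub_le_one_iff, sum_degrees_of_mem_graphs hG, hV,
    Nat.mul_div_mul_left m n two_pos]

lemma two_mul_log_omega (hn : 0 < n) (hV : Fintype.card V = 2 * n) (hG : G ∈ graphs V m) :
    2 * Real.log (omega n m) = Fintype.card V * logFac (m / n) +
      (∑ v, (G.degree v : ℝ) - Fintype.card V * (m / n : ℕ)) *
        (logFac (m / n + 1) - logFac (m / n)) := by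
  rw [log_omega hn, ← Nat.cast_sum, sum_degrees_of_mem_graphs hG, hV]
  push_cast
  ring

lemma two_mul_log_degProd (hG : 0 < degProd G) :
    2 * Real.log (degProd G) = ∑ v, logFac (G.degree v) := by
  simp only [log_degProd hG, logBound, degOn_univ, ← sum_div]
  ring

theorem degProd_le_omega (hn : 0 < n) (hnm : n ≤ m) (hV : Fintype.card V = 2 * n)
    (hG : G ∈ graphs V m) : degProd G ≤ omega n m := by
  rcases degProd_nonneg.eq_or_lt' (a := degProd G) with h | hpos
  · exact h ▸ (omega_pos n m).le
  rw [← Real.log_le_log_iff hpos (omega_pos n m), ← mul_le_mul_iff_right₀ two_pos,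
    two_mul_log_degProd hpos, two_mul_log_omega hn hV hG]
  exact sum_le_chord strictAntiOn_logFac_succ_sub (Nat.div_pos hnm hn) fun v =>
    Nat.pos_of_ne_zero (degProd_pos_iff.1 hpos v)

theorem degProd_eq_omega_iff (hn : 0 < n) (hnm : n ≤ m) (hV : Fintype.card V = 2 * n)
    (hG : G ∈ graphs V m) : degProd G = omega n m ↔ AlmostRegular G := by
  have hq : 1 ≤ m / n := Nat.div_pos hnm hn
  rw [almostRegular_iff hV hG]
  by_cases hpos : 0 < degProd G
  · rw [← Real.log_injOn_pos.eq_iff hpos (omega_pos n m), ← mul_right_inj' two_ne_zero,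
      two_mul_log_degProd hpos, two_mul_log_omega hn hV hG]
    exact sum_eq_chord_iff strictAntiOn_logFac_succ_sub hq fun v =>
      Nat.pos_of_ne_zero (degProd_pos_iff.1 hpos v)
  · refine iff_of_false (fun h => hpos (h ▸ omega_pos n m)) fun h => hpos ?_
    exact degProd_pos_iff.2 fun v => by have := h v; lia

end DegreeProduct

section Bicliques

variable {V W I J : Type*} {G : SimpleGraph V} {H : SimpleGraph W}

/-- Vertices with a common neighbour have the same neighbours. The name is the one used for binary
relations: adjacency is a difunctional relation. -/
def IsDifunctional (G : SimpleGraph V) : Prop :=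
  ∀ ⦃u v c d⦄, G.Adj u c → G.Adj v c → G.Adj u d → G.Adj v d

/-- A labelling of the vertices by a component and a side of it that exhibits `G` as a disjoint
union of complete bipartite graphs: the neighbours of a vertex are the vertices on the other side of
its component. -/
def IsBicliqueLabelling (G : SimpleGraph V) (p : V → I × Bool) : Prop :=
  ∀ v w, G.Adj v w ↔ p w = ((p v).1, !(p v).2)

namespace IsDifunctional

lemma not_adj_of_adj_of_adj (hG : IsDifunctional G) {u v c : V} (huc : G.Adj u c)
    (hvc : G.Adj v c) : ¬ G.Adj u v :=
  fun huv => G.irrefl (hG huc hvc huv)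

lemma eq_or_adj_or_exists_of_reachable (hG : IsDifunctional G) {v r : V} (h : G.Reachable v r) :
    v = r ∨ G.Adj v r ∨ ∃ c, G.Adj v c ∧ G.Adj r c := by
  obtain ⟨walk⟩ := h
  induction walk with
  | nil => exact .inl rfl
  | cons hvu _ ih =>
    rcases ih with rfl | hur | ⟨c, huc, hrc⟩
    · exact .inr (.inl hvu)
    · exact .inr (.inr ⟨_, hvu, hur.symm⟩)
    · exact .inr (.inl (hG huc.symm hvu hrc.symm))

lemma adj_iff_of_reachable (hG : IsDifunctional G) {v w r : V} (hv : G.Reachable v r)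
    (hw : G.Reachable w r) : G.Adj v w ↔ (G.Adj w r ↔ ¬ G.Adj v r) := by
  refine ⟨fun hvw => ⟨fun hwr hvr => hG.not_adj_of_adj_of_adj hvr hwr hvw, fun hvr => ?_⟩,
    fun h => ?_⟩
  · rcases hG.eq_or_adj_or_exists_of_reachable hv with rfl | hvr' | ⟨c, hvc, hrc⟩
    · exact hvw.symm
    · exact absurd hvr' hvr
    · exact (hG hvc hrc hvw).symm
  · by_cases hvr : G.Adj v r
    · rcases hG.eq_or_adj_or_exists_of_reachable hw with rfl | hwr | ⟨c, hwc, hrc⟩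
      · exact hvr
      · exact absurd hvr (h.1 hwr)
      · exact (hG hrc hwc hvr.symm).symm
    · have hwr := h.2 hvr
      rcases hG.eq_or_adj_or_exists_of_reachable hv with rfl | hvr' | ⟨c, hvc, hrc⟩
      · exact hwr.symm
      · exact absurd hvr' hvr
      · exact hG hrc hvc hwr.symm

lemma exists_isBicliqueLabelling (hG : IsDifunctional G) :
    ∃ p : V → G.ConnectedComponent × Bool,
      IsBicliqueLabelling G p ∧ ∀ v, (p v).1 = G.connectedComponentMk v := by
  classical
  let root (v : V) : V := (G.connectedComponentMk v).out
  have hroot (v : V) : G.Reachable v (root v) :=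
    SimpleGraph.ConnectedComponent.exact (Quot.out_eq _).symm
  refine ⟨fun v => (G.connectedComponentMk v, decide (G.Adj v (root v))), fun v w => ?_,
    fun _ => rfl⟩
  by_cases hvw : G.connectedComponentMk w = G.connectedComponentMk v
  · have hwr : root w = root v := congrArg Quot.out hvw
    rw [hG.adj_iff_of_reachable (hroot v) (hwr ▸ hroot w)]
    by_cases hv : G.Adj v (root v) <;> simp [hvw, hwr, hv]
  · refine iff_of_false (fun hadj => hvw ?_) fun h => hvw (congrArg Prod.fst h)
    exact SimpleGraph.ConnectedComponent.sound hadj.symm.reachable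

end IsDifunctional

namespace IsBicliqueLabelling

variable {p : V → I × Bool} {q : W → J × Bool}

lemma degree_eq_card [Fintype V] [DecidableRel G.Adj] (hp : IsBicliqueLabelling G p) (v : V) :
    G.degree v = Nat.card {w // p w = ((p v).1, !(p v).2)} := by
  rw [← SimpleGraph.card_neighborSet_eq_degree, ← Nat.card_eq_fintype_card]
  exact Nat.card_congr (Equiv.subtypeEquivRight (hp v))

lemma card_eq_degree [Fintype V] [DecidableRel G.Adj] (hp : IsBicliqueLabelling G p)
    (hG : ∀ ⦃v w⦄, G.Adj v w → G.degree v = G.degree w) {v : V} (hv : G.degree v ≠ 0) (x : Bool) :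
    Nat.card {w // p w = ((p v).1, x)} = G.degree v := by
  by_cases hx : x = !(p v).2
  · rw [hx, hp.degree_eq_card]
  · obtain ⟨w, hvw⟩ := (G.degree_pos_iff_exists_adj v).1 (Nat.pos_of_ne_zero hv)
    rw [hG hvw, hp.degree_eq_card, (hp v w).1 hvw, Bool.not_not, ← Bool.not_not (p v).2,
      ← Bool.eq_not.2 hx]

lemma nonempty_iso [Finite V] [Finite W] (hp : IsBicliqueLabelling G p)
    (hq : IsBicliqueLabelling H q) (e : I ≃ J)
    (hcard : ∀ i x, Nat.card {v // p v = (i, x)} = Nat.card {w // q w = (e i, x)}) :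
    Nonempty (G ≃g H) := by
  let parts (j : I × Bool) : {v // p v = j} ≃ {w // q w = e.prodCongr (Equiv.refl Bool) j} :=
    (Finite.card_eq.1 (hcard j.1 j.2)).some
  let ψ : V ≃ W := (Equiv.sigmaFiberEquiv p).symm.trans
    ((Equiv.sigmaCongr (e.prodCongr (Equiv.refl Bool)) parts).trans (Equiv.sigmaFiberEquiv q))
  have hψ (v : V) : q (ψ v) = (e (p v).1, (p v).2) := (parts (p v) ⟨v, rfl⟩).2
  exact ⟨⟨ψ, fun {v w} => by simp [hp v w, hq (ψ v) (ψ w), hψ, Prod.ext_iff]⟩⟩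

end IsBicliqueLabelling

lemma exists_equiv_fin_sum_fin [Finite I] (P : I → Prop) :
    ∃ (l₁ l₂ : ℕ) (e : I ≃ Fin l₁ ⊕ Fin l₂), ∀ i, (e i).isLeft ↔ P i := by
  classical
  refine ⟨_, _, (Equiv.sumCompl P).symm.trans
    ((Finite.equivFin _).sumCongr (Finite.equivFin _)), fun i => ?_⟩
  by_cases hi : P i <;> simp [hi]

variable {l₁ l₂ k : ℕ}

/-- The component and the side of a vertex of `unionK l₁ l₂ k`. -/
def unionKLabel : (Fin l₁ × (Fin k ⊕ Fin k)) ⊕ (Fin l₂ × (Fin (k + 1) ⊕ Fin (k + 1))) →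
    (Fin l₁ ⊕ Fin l₂) × Bool :=
  Sum.elim (fun v => (.inl v.1, v.2.isLeft)) fun v => (.inr v.1, v.2.isLeft)

lemma isBicliqueLabelling_unionK : IsBicliqueLabelling (unionK l₁ l₂ k) unionKLabel := by
  rintro (⟨i, v | v⟩ | ⟨i, v | v⟩) (⟨j, w | w⟩ | ⟨j, w | w⟩) <;>
    simp [unionK, copies, unionKLabel, eq_comm (a := j)]

lemma card_unionKLabel_eq (i : Fin l₁ ⊕ Fin l₂) (x : Bool) :
    Nat.card {w // unionKLabel (k := k) w = (i, x)} = if i.isLeft then k else k + 1 := by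
  classical
  rw [Nat.card_eq_fintype_card, Fintype.card_subtype, card_filter]
  simp only [Fintype.sum_sum_type, Fintype.sum_prod_type]
  rcases i with i | i <;> cases x <;> simp [unionKLabel]

theorem exists_iso_unionK [Fintype V] [DecidableRel G.Adj] (hG : IsDifunctional G)
    (hadj : ∀ ⦃v w⦄, G.Adj v w → G.degree v = G.degree w) (hk : k ≠ 0)
    (hdeg : ∀ v, G.degree v = k ∨ G.degree v = k + 1) :
    ∃ l₁ l₂, Nonempty (G ≃g unionK l₁ l₂ k) := by
  obtain ⟨p, hp, hcomp⟩ := hG.exists_isBicliqueLabelling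
  obtain ⟨l₁, l₂, e, he⟩ := exists_equiv_fin_sum_fin fun i => Nat.card {v // p v = (i, true)} = k
  refine ⟨l₁, l₂, hp.nonempty_iso isBicliqueLabelling_unionK e fun i x => ?_⟩
  induction i using SimpleGraph.ConnectedComponent.ind with | h v => ?_
  have hpart := hp.card_eq_degree hadj (v := v) (by have := hdeg v; lia)
  rw [hcomp] at hpart
  rw [card_unionKLabel_eq, hpart]
  simp only [he, hpart]
  have := hdeg v
  split_ifs <;> lia

end Bicliques

section Extremal

variable {V W : Type*} {G : SimpleGraph V} {H : SimpleGraph W} {n m l₁ l₂ l₁' l₂' k : ℕ}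

lemma mem_graphs_iff_of_iso (ψ : G ≃g H) : G ∈ graphs V m ↔ H ∈ graphs W m := by
  have hcard := Nat.card_congr ψ.mapEdgeSet
  rw [Nat.card_coe_set_eq, Nat.card_coe_set_eq] at hcard
  exact ⟨hcard.symm.trans, hcard.trans⟩

lemma card_unionK :
    Fintype.card ((Fin l₁ × (Fin k ⊕ Fin k)) ⊕ (Fin l₂ × (Fin (k + 1) ⊕ Fin (k + 1)))) =
      2 * (l₁ * k + l₂ * (k + 1)) := by
  simp only [Fintype.card_prod, Fintype.card_sum, Fintype.card_fin]
  ring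

lemma unionK_mem_graphs : unionK l₁ l₂ k ∈ graphs _ (l₁ * k ^ 2 + l₂ * (k + 1) ^ 2) := by
  classical
  have hsum := sum_degrees_of_mem_graphs (G := unionK l₁ l₂ k) rfl
  simp only [isBicliqueLabelling_unionK.degree_eq_card, card_unionKLabel_eq] at hsum
  simp only [unionKLabel, Fintype.sum_sum_type, Sum.elim_inl, Sum.elim_inr, Sum.isLeft_inl,
    Sum.isLeft_inr, if_true, Bool.false_eq_true, if_false, sum_const, card_univ, Fintype.card_prod,
    Fintype.card_sum, Fintype.card_fin, smul_eq_mul] at hsum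
  change _ = _
  linarith

lemma eq_and_eq_of_iso_unionK [Fintype V] (hV : Fintype.card V = 2 * n) (hG : G ∈ graphs V m)
    (ψ : G ≃g unionK l₁ l₂ k) :
    n = l₁ * k + l₂ * (k + 1) ∧ m = l₁ * k ^ 2 + l₂ * (k + 1) ^ 2 := by
  have hcard := Fintype.card_congr ψ.toEquiv
  rw [hV, card_unionK] at hcard
  exact ⟨Nat.eq_of_mul_eq_mul_left two_pos hcard,
    ((mem_graphs_iff_of_iso ψ).1 hG).symm.trans unionK_mem_graphs⟩

lemma unionK_edges_div_eq (hl : 1 ≤ l₁) (hk : 1 ≤ k) :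
    (l₁ * k ^ 2 + l₂ * (k + 1) ^ 2) / (l₁ * k + l₂ * (k + 1)) = k := by
  have hpos : 0 < l₁ * k := Nat.mul_pos hl hk
  exact Nat.div_eq_of_lt_le (by nlinarith) (by nlinarith)

lemma one_le_of_unionK_edges_div_eq (hn : 0 < l₁ * k + l₂ * (k + 1))
    (h : (l₁ * k ^ 2 + l₂ * (k + 1) ^ 2) / (l₁ * k + l₂ * (k + 1)) = k) : 1 ≤ l₁ := by
  by_contra! hl
  obtain rfl : l₁ = 0 := by lia
  rw [zero_mul, zero_mul, zero_add, zero_add, sq, ← mul_assoc,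
    Nat.mul_div_cancel_left _ (by simpa using hn)] at h
  lia

lemma unionK_params_unique (hk : 1 ≤ k)
    (hn : l₁ * k + l₂ * (k + 1) = l₁' * k + l₂' * (k + 1))
    (hm : l₁ * k ^ 2 + l₂ * (k + 1) ^ 2 = l₁' * k ^ 2 + l₂' * (k + 1) ^ 2) :
    l₁ = l₁' ∧ l₂ = l₂' := by
  have hlarge : l₂ * (k + 1) = l₂' * (k + 1) := by
    zify at hn hm ⊢
    linear_combination hm - k * hn
  exact ⟨Nat.eq_of_mul_eq_mul_right hk (by lia), Nat.eq_of_mul_eq_mul_right k.succ_pos hlarge⟩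

lemma omega_unionK (hl : 1 ≤ l₁) (hk : 1 ≤ k) :
    omega (l₁ * k + l₂ * (k + 1)) (l₁ * k ^ 2 + l₂ * (k + 1) ^ 2) = k ! ^ l₁ * (k + 1)! ^ l₂ := by
  refine Real.log_injOn_pos (omega_pos _ _) (show (0 : ℝ) < _ by positivity) ?_
  rw [log_omega (Nat.add_pos_left (Nat.mul_pos hl hk) _), unionK_edges_div_eq hl hk,
    Real.log_mul (by positivity) (by positivity), Real.log_pow, Real.log_pow, ← mul_logFac,
    ← mul_logFac]
  push_cast
  ring

theorem perfmat_le_omega [Fintype V] (hn : 0 < n) (hnm : n ≤ m) (hV : Fintype.card V = 2 * n)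
    (hG : G ∈ graphs V m) : (perfmat G : ℝ) ≤ omega n m := by
  classical
  exact perfmat_le_degProd.trans (degProd_le_omega hn hnm hV hG)

theorem exists_iso_unionK_of_perfmat_eq_omega [Fintype V] (hn : 0 < n) (hnm : n ≤ m)
    (hV : Fintype.card V = 2 * n) (hG : G ∈ graphs V m) (h : (perfmat G : ℝ) = omega n m) :
    ∃ l₁ l₂, 1 ≤ l₁ ∧ Nonempty (G ≃g unionK l₁ l₂ (m / n)) := by
  classical
  have hk : m / n ≠ 0 := (Nat.div_pos hnm hn).ne'
  have hprod : degProd G = omega n m :=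
    (degProd_le_omega hn hnm hV hG).antisymm (h ▸ perfmat_le_degProd)
  have hdeg := (almostRegular_iff hV hG).1 ((degProd_eq_omega_iff hn hnm hV hG).1 hprod)
  have htight := isTight_univ_of_perfmat_eq_degProd (hprod ▸ omega_pos n m) (h.trans hprod.symm)
  have hadj ⦃v w : V⦄ (hvw : G.Adj v w) : G.degree v = G.degree w := by
    simpa only [degOn_univ] using htight.degOn_eq_of_adj (mem_univ v) (mem_univ w) hvw
  have hdifunctional : IsDifunctional G := fun u v c d =>
    htight.adj_of_adj_of_adj_of_adj (mem_univ u) (mem_univ v) (mem_univ c) (mem_univ d)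
  obtain ⟨l₁, l₂, ⟨ψ⟩⟩ := exists_iso_unionK hdifunctional hadj hk hdeg
  obtain ⟨hn', hm'⟩ := eq_and_eq_of_iso_unionK hV hG ψ
  exact ⟨l₁, l₂, one_le_of_unionK_edges_div_eq (hn' ▸ hn) (by rw [← hn', ← hm']), ⟨ψ⟩⟩

theorem perfmat_unionK (hl : 1 ≤ l₁) (hk : 1 ≤ k) : (perfmat (unionK l₁ l₂ k) : ℝ) =
    omega (l₁ * k + l₂ * (k + 1)) (l₁ * k ^ 2 + l₂ * (k + 1) ^ 2) := by
  refine le_antisymm (perfmat_le_omega (Nat.add_pos_left (Nat.mul_pos hl hk) _) ?_ card_unionK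
    unionK_mem_graphs) ?_
  · gcongr <;> exact Nat.le_self_pow two_ne_zero _
  · rw [omega_unionK hl hk]
    exact_mod_cast factorial_pow_mul_factorial_pow_le_perfmat_unionK l₁ l₂ k

theorem perfmat_eq_omega_iff [Fintype V] (hl : 1 ≤ l₁) (hk : 1 ≤ k)
    (hn : n = l₁ * k + l₂ * (k + 1)) (hm : m = l₁ * k ^ 2 + l₂ * (k + 1) ^ 2)
    (hV : Fintype.card V = 2 * n) (hG : G ∈ graphs V m) :
    (perfmat G : ℝ) = omega n m ↔ Nonempty (G ≃g unionK l₁ l₂ k) := by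
  subst hn hm
  refine ⟨fun h => ?_, fun ⟨ψ⟩ => by rw [perfmat_congr ψ, perfmat_unionK hl hk]⟩
  have hnm : l₁ * k + l₂ * (k + 1) ≤ l₁ * k ^ 2 + l₂ * (k + 1) ^ 2 := by
    gcongr <;> exact Nat.le_self_pow two_ne_zero _
  obtain ⟨l₁', l₂', -, ⟨ψ⟩⟩ := exists_iso_unionK_of_perfmat_eq_omega
    (Nat.add_pos_left (Nat.mul_pos hl hk) _) hnm hV hG h
  rw [unionK_edges_div_eq hl hk] at ψ
  obtain ⟨hn', hm'⟩ := eq_and_eq_of_iso_unionK hV hG ψ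
  obtain ⟨rfl, rfl⟩ := unionK_params_unique hk hn' hm'
  exact ⟨ψ⟩

lemma graphs_nonempty [Fintype V] (hm : m ≤ (Fintype.card V).choose 2) :
    (graphs V m).Nonempty := by
  classical
  rw [← SimpleGraph.card_edgeFinset_top_eq_card_choose_two, ← Set.ncard_coe_finset,
    SimpleGraph.coe_edgeFinset] at hm
  obtain ⟨E, hE, rfl⟩ := Set.exists_subset_card_eq hm
  refine ⟨(⊤ : SimpleGraph V).deleteEdges ((⊤ : SimpleGraph V).edgeSet \ E), congrArg _ ?_⟩
  rw [SimpleGraph.edgeSet_deleteEdges, Set.sdiff_sdiff_cancel_left hE]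

lemma isGreatest_mu (hm : m ≤ (2 * n).choose 2) :
    IsGreatest (perfmat '' graphs (Fin (2 * n)) m) (mu n m) := by
  have hfin : (perfmat '' graphs (Fin (2 * n)) m).Finite := (Set.toFinite _).image _
  exact ⟨Nat.sSup_mem ((graphs_nonempty (by rwa [Fintype.card_fin])).image _) hfin.bddAbove,
    fun _ hx => le_csSup hfin.bddAbove hx⟩

theorem mu_le_omega (hn : 0 < n) (hnm : n ≤ m) (hm : m ≤ (2 * n).choose 2) :
    (mu n m : ℝ) ≤ omega n m := by
  obtain ⟨G, hG, hGmu⟩ := (isGreatest_mu hm).1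
  exact hGmu ▸ perfmat_le_omega hn hnm (Fintype.card_fin _) hG

lemma exists_iso_unionK_of_eq_of_eq (hn : n = l₁ * k + l₂ * (k + 1))
    (hm : m = l₁ * k ^ 2 + l₂ * (k + 1) ^ 2) :
    ∃ G ∈ graphs (Fin (2 * n)) m, Nonempty (G ≃g unionK l₁ l₂ k) := by
  subst hn hm
  let vertexEquiv := Fintype.equivOfCardEq
    ((Fintype.card_fin _).trans (card_unionK (l₁ := l₁) (l₂ := l₂) (k := k)).symm)
  let ψ := SimpleGraph.Iso.comap vertexEquiv (unionK l₁ l₂ k)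
  exact ⟨_, (mem_graphs_iff_of_iso ψ).2 unionK_mem_graphs, ⟨ψ⟩⟩

theorem exists_iso_unionK_iff :
    (∃ G ∈ graphs (Fin (2 * n)) m, ∃ l₁ l₂ k : ℕ, 1 ≤ l₁ ∧ 1 ≤ k ∧
        Nonempty (G ≃g unionK l₁ l₂ k)) ↔
      ∃ l₁ l₂ k : ℕ, 1 ≤ l₁ ∧ 1 ≤ k ∧
        n = l₁ * k + l₂ * (k + 1) ∧ m = l₁ * k ^ 2 + l₂ * (k + 1) ^ 2 := by
  constructor
  · rintro ⟨G, hG, l₁, l₂, k, hl, hk, ⟨ψ⟩⟩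
    exact ⟨l₁, l₂, k, hl, hk, eq_and_eq_of_iso_unionK (Fintype.card_fin _) hG ψ⟩
  · rintro ⟨l₁, l₂, k, hl, hk, hn, hm⟩
    obtain ⟨G, hG, hψ⟩ := exists_iso_unionK_of_eq_of_eq hn hm
    exact ⟨G, hG, l₁, l₂, k, hl, hk, hψ⟩

theorem mu_eq_omega_iff (hn : 0 < n) (hnm : n ≤ m) (hm : m ≤ (2 * n).choose 2) :
    (mu n m : ℝ) = omega n m ↔
      ∃ G ∈ graphs (Fin (2 * n)) m, ∃ l₁ l₂ k : ℕ, 1 ≤ l₁ ∧ 1 ≤ k ∧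
        Nonempty (G ≃g unionK l₁ l₂ k) := by
  constructor
  · obtain ⟨G, hG, hGmu⟩ := (isGreatest_mu hm).1
    intro h
    obtain ⟨l₁, l₂, hl, hψ⟩ := exists_iso_unionK_of_perfmat_eq_omega hn hnm (Fintype.card_fin _)
      hG (hGmu ▸ h)
    exact ⟨G, hG, l₁, l₂, m / n, hl, Nat.div_pos hnm hn, hψ⟩
  · rintro ⟨G, hG, l₁, l₂, k, hl, hk, ⟨ψ⟩⟩
    obtain ⟨hn', hm'⟩ := eq_and_eq_of_iso_unionK (Fintype.card_fin _) hG ψ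
    have hmax := (perfmat_eq_omega_iff hl hk hn' hm' (Fintype.card_fin _) hG).2 ⟨ψ⟩
    refine (mu_le_omega hn hnm hm).antisymm (hmax ▸ ?_)
    exact_mod_cast (isGreatest_mu hm).2 ⟨G, hG, rfl⟩

end Extremal

end PerfMatBound

theorem mainTheorem1 (n m : ℕ) (hn : 0 < n) (hnm : n ≤ m) (hm : m ≤ (2 * n).choose 2) :
    -- the degree product bound with its equality case, and the bound on perfect matchings
    (∀ (V : Type*) [Fintype V] (G : SimpleGraph V) [DecidableRel G.Adj],
      Fintype.card V = 2 * n → G ∈ PerfMatBound.graphs V m →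
        PerfMatBound.degProd G ≤ PerfMatBound.omega n m ∧
        (PerfMatBound.degProd G = PerfMatBound.omega n m ↔ PerfMatBound.AlmostRegular G) ∧
        (PerfMatBound.perfmat G : ℝ) ≤ PerfMatBound.omega n m) ∧
    -- the maximum `μ(2n, m)` is attained and is at most `ω(2n, m)`
    IsGreatest (PerfMatBound.perfmat '' PerfMatBound.graphs (Fin (2 * n)) m)
      (PerfMatBound.mu n m) ∧
    (PerfMatBound.mu n m : ℝ) ≤ PerfMatBound.omega n m ∧
    -- equality holds iff there is a graph of the form `l₁ K_{k,k} ∪ l₂ K_{k+1,k+1}`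
    ((PerfMatBound.mu n m : ℝ) = PerfMatBound.omega n m ↔
      ∃ G ∈ PerfMatBound.graphs (Fin (2 * n)) m, ∃ l₁ l₂ k : ℕ, 1 ≤ l₁ ∧ 1 ≤ k ∧
        Nonempty (G ≃g PerfMatBound.unionK l₁ l₂ k)) ∧
    -- that is, iff `n` and `m` have the corresponding form
    ((PerfMatBound.mu n m : ℝ) = PerfMatBound.omega n m ↔
      ∃ l₁ l₂ k : ℕ, 1 ≤ l₁ ∧ 1 ≤ k ∧
        n = l₁ * k + l₂ * (k + 1) ∧ m = l₁ * k ^ 2 + l₂ * (k + 1) ^ 2) ∧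
    -- in that case this graph is, up to isomorphism, the unique maximizer
    (∀ l₁ l₂ k : ℕ, 1 ≤ l₁ → 1 ≤ k →
      n = l₁ * k + l₂ * (k + 1) → m = l₁ * k ^ 2 + l₂ * (k + 1) ^ 2 →
      ∀ (V : Type*) [Fintype V] (G : SimpleGraph V),
        Fintype.card V = 2 * n → G ∈ PerfMatBound.graphs V m →
          (PerfMatBound.perfmat G = PerfMatBound.mu n m ↔
            Nonempty (G ≃g PerfMatBound.unionK l₁ l₂ k))) := by
  have hmu := PerfMatBound.mu_eq_omega_iff hn hnm hm
  have hparams := hmu.trans PerfMatBound.exists_iso_unionK_iff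
  refine ⟨fun V _ G _ hV hG => ⟨PerfMatBound.degProd_le_omega hn hnm hV hG,
      PerfMatBound.degProd_eq_omega_iff hn hnm hV hG,
      PerfMatBound.perfmat_le_omega hn hnm hV hG⟩,
    PerfMatBound.isGreatest_mu hm, PerfMatBound.mu_le_omega hn hnm hm, hmu, hparams,
    fun l₁ l₂ k hl hk hn' hm' V _ G hV hG => ?_⟩
  rw [← PerfMatBound.perfmat_eq_omega_iff hl hk hn' hm' hV hG,
    ← hparams.2 ⟨l₁, l₂, k, hl, hk, hn', hm'⟩, Nat.cast_inj]
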